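/- Let $K\subseteq\mathbb R^n$ be nonempty, closed and convex. Let $f:\mathbb R^n\to\mathbb R$, $g=(g_1,\dots,g_m):\mathbb R^n\to\mathbb R^m$ and $h=(h_1,\dots,h_p):\mathbb R^n\to\mathbb R^p$ be continuously differentiable with locally Lipschitz continuous gradients on an open set containing $K$, and let $q:\mathbb R^n\to\mathbb R$ be convex on $K$ and locally Lipschitz continuous on an open set containing $K$. Put $\varphi(x)=\max_{i,j}\{g_i(x)_+,|h_j(x)|\}$ and $\tilde h_j(d;x)=h_j(x)+\nabla h_j(x)^{T}d$. Let $\lambda\in(0,1)$ and $0<\rho<\beta$, and let $O_d$ and $O_x$ be open sets containing $\{d:\|d\|_\infty\le\beta\}$ and $K$, respectively. Let $\tilde f:O_d\times O_x\to\mathbb R$ and $\tilde g_i:\mathbb R^n\times O_x\to\mathbb R$ ($i=1,\dots,m$) be continuously differentiable on $O_d$ with respect to the first argument, and assume: - $\tilde f(\cdot;x)$ is strongly convex on $O_d$ for every $x\in K$, with a modulus $c>0$ independent of $x$; $\tilde f$ and $\nabla_1\tilde f$ are continuous on $O_d\times O_x$; and $\nabla_1\tilde f(0;x)=\nabla f(x)$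 for every $x\in K$; - each $\tilde g_i(\cdot;x)$ is convex on $O_d$ for every $x\in K$; $\tilde g_i$ is continuous on $\mathbb R^n\times O_x$ and $\nabla_1\tilde g_i$ is continuous on $O_d\times O_x$; and $\tilde g_i(0;x)=g_i(x)$, $\nabla_1\tilde g_i(0;x)=\nabla g_i(x)$ for every $x\in K$; - $\tilde f$ and all $\tilde g_i$ are locally Lipschitz continuous on $O_d\times O_x$. For $x\in K$ let $$\kappa(x)=(1-\lambda)\varphi(x)+\lambda\min_d\Big\{\max_{i,j}\{\tilde g_i(d;x)_+,|\tilde h_j(d;x)|\}\;:\;\|d\|_\infty\le\rho,\ x+d\in K\Big\},$$ and consider the problem $$(P_x)\qquad \min_d\ \tilde f(d;x)+q(x+d)\quad\text{s.t. } \tilde g_i(d;x)\le\kappa(x)\ \forall i,\ \ |\tilde h_j(d;x)|\le\kappa(x)\ \forall j,\ \ \|d\|_\infty\le\beta,\ \ x+d\in K.$$ Suppose that at every $x\in K$ the extended Mangasarian-Fromovitz constraint qualification holds: the only pair $(\xi,\pi)\in\mathbb R^m\times\mathbb R^p$ such that $\xi\in N_{\mathbb R^m_-}\big((g_i(x)-\varphi(x))_i\big)$,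 $\pi\in N_{\{u:\|u\|_\infty\le\varphi(x)\}}(h(x))$ and $0\in\sum_i\xi_i\nabla g_i(x)+\sum_j\pi_j\nabla h_j(x)+N_K(x)$ is $(\xi,\pi)=(0,0)$, where $N_C(y)$ denotes the normal cone to the convex set $C$ at $y$. Then for every $x\in K$ the problem $(P_x)$ has exactly one solution $d(x)$, and for every compact set $S\subseteq K$ there exists $\mu>0$ such that $$\|d(y)-d(z)\|\le\mu\,\|y-z\|^{1/2}\qquad\text{for all }y,z\in S.$$ -/

import Mathlib

open scoped Gradient

noncomputable section

namespace GhostPenalty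

/-- `ℝⁿ` with the Euclidean inner product and norm. -/
abbrev Vec (n : ℕ) : Type := EuclideanSpace ℝ (Fin n)

/-- The norm `‖v‖_∞ = max_i |v_i|` of a vector of `ℝⁿ`. -/
def infNorm {n : ℕ} (v : Vec n) : ℝ := ‖(WithLp.ofLp v : Fin n → ℝ)‖

/-- The normal cone (of convex analysis) to `C` at `x`; it is empty if `x ∉ C`. -/
def normalCone {n : ℕ} (C : Set (Vec n)) (x : Vec n) : Set (Vec n) :=
  {v | x ∈ C ∧ ∀ y ∈ C, inner ℝ v (y - x) ≤ 0}

/-- `f` is of class `C^{1,1}` on an open set containing `K`: continuously differentiable with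
locally Lipschitz continuous gradient. -/
def IsC11Near {n : ℕ} (f : Vec n → ℝ) (K : Set (Vec n)) : Prop :=
  ∃ U : Set (Vec n), IsOpen U ∧ K ⊆ U ∧ ContDiffOn ℝ 1 f U ∧
    LocallyLipschitzOn U (fun x => ∇ f x)

/-- `max_{i,j} {(a_i)_+, |b_j|}` (equal to `0` when there are no indices at all). -/
def violation {m p : ℕ} (a : Fin m → ℝ) (b : Fin p → ℝ) : ℝ :=
  max ‖fun i => max (a i) 0‖ ‖b‖

/-- The data of the problem: minimize `f x + q x` subject to `g x ≤ 0`, `h x = 0`, `x ∈ K`. -/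
structure Problem (n m p : ℕ) where
  f : Vec n → ℝ
  q : Vec n → ℝ
  g : Fin m → Vec n → ℝ
  h : Fin p → Vec n → ℝ
  K : Set (Vec n)

/-- The data of the direction finding subproblem: the surrogates `f̃ d x` and `g̃ i d x`
of `f` and `g i`, and the parameters `β`, `ρ`, `λ`. -/
structure Surrogate (n m : ℕ) where
  ft : Vec n → Vec n → ℝ
  gt : Fin m → Vec n → Vec n → ℝ
  β : ℝ
  ρ : ℝ
  lam : ℝ

namespace Problem

variable {n m p : ℕ}

/-- The regularity of the data of the problem. -/
structure Regular (P : Problem n m p) : Prop where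
  nonempty_K : P.K.Nonempty
  isClosed_K : IsClosed P.K
  convex_K : Convex ℝ P.K
  f_C11 : IsC11Near P.f P.K
  g_C11 : ∀ i, IsC11Near (P.g i) P.K
  h_C11 : ∀ j, IsC11Near (P.h j) P.K
  q_convexOn : ConvexOn ℝ P.K P.q
  q_locallyLipschitz : ∃ U : Set (Vec n), IsOpen U ∧ P.K ⊆ U ∧ LocallyLipschitzOn U P.q

/-- The infeasibility measure `φ(x) = max_{i,j} {g_i(x)_+, |h_j(x)|}`. -/
def phi (P : Problem n m p) (x : Vec n) : ℝ :=
  violation (fun i => P.g i x) (fun j => P.h j x)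

/-- The set `M₀(x)` of abnormal multipliers `(ξ, π)`. -/
def abnormalMultipliers (P : Problem n m p) (x : Vec n) : Set (Vec m × Vec p) :=
  {w | w.1 ∈ normalCone {u : Vec m | ∀ i, u i ≤ 0}
          (WithLp.toLp 2 fun i => P.g i x - P.phi x) ∧
       w.2 ∈ normalCone {u : Vec p | infNorm u ≤ P.phi x} (WithLp.toLp 2 fun j => P.h j x) ∧
       ∃ η ∈ normalCone P.K x,
         (∑ i, w.1 i • ∇ (P.g i) x) + (∑ j, w.2 j • ∇ (P.h j) x) + η = 0}

/-- The extended Mangasarian-Fromovitz constraint qualification at `x`. -/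
def EMFCQ (P : Problem n m p) (x : Vec n) : Prop :=
  P.abnormalMultipliers x = {0}

/-- The linearization `h̃_j(d; x) = h_j(x) + ∇h_j(x)ᵀ d`. -/
def ht (P : Problem n m p) (j : Fin p) (d x : Vec n) : ℝ :=
  P.h j x + inner ℝ (∇ (P.h j) x) d

/-- The relaxation term `κ(x)`. The infimum is that of a continuous nonnegative function over a
nonempty compact set. -/
def kappa (P : Problem n m p) (T : Surrogate n m) (x : Vec n) : ℝ :=
  (1 - T.lam) * P.phi x +
    T.lam * sInf ((fun d => violation (fun i => T.gt i d x) (fun j => P.ht j d x)) ''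
      {d | infNorm d ≤ T.ρ ∧ x + d ∈ P.K})

/-- The feasible set of the subproblem at `x`. -/
def subFeasible (P : Problem n m p) (T : Surrogate n m) (x : Vec n) : Set (Vec n) :=
  {d | (∀ i, T.gt i d x ≤ P.kappa T x) ∧
       (∀ j, -P.kappa T x ≤ P.ht j d x ∧ P.ht j d x ≤ P.kappa T x) ∧
       infNorm d ≤ T.β ∧ x + d ∈ P.K}

/-- `d` is a solution of the subproblem at `x`: minimize `f̃(d; x) + q(x + d)` over its feasible
set. -/
def IsSubSolution (P : Problem n m p) (T : Surrogate n m) (x d : Vec n) : Prop :=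
  d ∈ P.subFeasible T x ∧ IsMinOn (fun e => T.ft e x + P.q (x + e)) (P.subFeasible T x) d

/-- The solution map `x ↦ d(x)` of the subproblem (some solution if there is one, an arbitrary
vector otherwise). -/
def solutionMap (P : Problem n m p) (T : Surrogate n m) (x : Vec n) : Vec n :=
  Classical.epsilon fun d => P.IsSubSolution T x d

end Problem

namespace Surrogate

variable {n m p : ℕ}

/-- The standing requirements on the surrogates, with respect to the sets `Od` and `Ox`. -/
structure Admissible (T : Surrogate n m) (P : Problem n m p) (Od Ox : Set (Vec n)) : Prop where
  lam_pos : 0 < T.lam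
  lam_lt_one : T.lam < 1
  rho_pos : 0 < T.ρ
  rho_lt_beta : T.ρ < T.β
  isOpen_Od : IsOpen Od
  ball_subset_Od : {d : Vec n | infNorm d ≤ T.β} ⊆ Od
  isOpen_Ox : IsOpen Ox
  K_subset_Ox : P.K ⊆ Ox
  ft_contDiffOn : ∀ x ∈ Ox, ContDiffOn ℝ 1 (fun d => T.ft d x) Od
  gt_contDiffOn : ∀ i, ∀ x ∈ Ox, ContDiffOn ℝ 1 (fun d => T.gt i d x) Od
  ft_strongConvexOn : ∃ c : ℝ, 0 < c ∧ ∀ x ∈ P.K, StrongConvexOn Od c fun d => T.ft d x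
  ft_continuousOn : ContinuousOn (fun z : Vec n × Vec n => T.ft z.1 z.2) (Od ×ˢ Ox)
  grad_ft_continuousOn :
    ContinuousOn (fun z : Vec n × Vec n => ∇ (fun d => T.ft d z.2) z.1) (Od ×ˢ Ox)
  grad_ft_zero : ∀ x ∈ P.K, ∇ (fun d => T.ft d x) 0 = ∇ P.f x
  gt_convexOn : ∀ i, ∀ x ∈ P.K, ConvexOn ℝ Od fun d => T.gt i d x
  gt_continuousOn : ∀ i,
    ContinuousOn (fun z : Vec n × Vec n => T.gt i z.1 z.2) (Set.univ ×ˢ Ox)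
  gt_zero : ∀ i, ∀ x ∈ P.K, T.gt i 0 x = P.g i x
  grad_gt_continuousOn : ∀ i,
    ContinuousOn (fun z : Vec n × Vec n => ∇ (fun d => T.gt i d z.2) z.1) (Od ×ˢ Ox)
  grad_gt_zero : ∀ i, ∀ x ∈ P.K, ∇ (fun d => T.gt i d x) 0 = ∇ (P.g i) x

/-- The surrogates are jointly locally Lipschitz continuous on `Od × Ox`. -/
structure LocallyLipschitz (T : Surrogate n m) (Od Ox : Set (Vec n)) : Prop where
  ft_locallyLipschitz : LocallyLipschitzOn (Od ×ˢ Ox) fun z : Vec n × Vec n => T.ft z.1 z.2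
  gt_locallyLipschitz : ∀ i,
    LocallyLipschitzOn (Od ×ˢ Ox) fun z : Vec n × Vec n => T.gt i z.1 z.2

end Surrogate

end GhostPenalty

end

/-! Well-posedness: the step that attains the minimum inside `kappa` is feasible, because that
minimum is at most `phi x` (compare with the zero step) and hence at most `kappa`. The feasible set
is thus nonempty, compact and convex. Strong convexity of the objective gives a unique minimizer,
with quadratic growth around it (`isSubSolution_quadratic_growth`).

Hölder continuity: suppose the feasible set depends on `x` in a Lipschitz way on `S`
(`exists_subFeasible_lipschitz`). Then the solution at `y` is within `O(‖y - z‖)` of a point `e`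
feasible at `z`. Exchanging the roles of `y` and `z` shows that the optimal values also differ by
`O(‖y - z‖)`, so `e` is `O(‖y - z‖)`-optimal at `z`. Quadratic growth turns this into a distance of
order `‖y - z‖ ^ (1/2)` from the solution at `z`.

The Lipschitz property is a Robinson-type argument. By separation, EMFCQ says that `0` is interior
to the set of attainable linearized values (`zero_mem_interior_linearizedValues`). Short multiples
of the resulting directions, averaged with the minimizing step in the proportions that define
`kappa`, give steps with uniform slack (`exists_regular_steps`). The slack survives small changes of
`x` (`exists_regularAt_nearby`) and is uniform on `S` by compactness. Moving an almost feasible step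
slightly towards such a step repairs its violation (`RegularAt.exists_mem_subFeasible`). -/

open scoped Gradient

noncomputable section

namespace GhostPenalty

/-! ### Separation of convex sets in finite dimension -/

section Separation

/-- Weak separation of a point from a convex set in a finite-dimensional space. -/
theorem exists_ne_zero_forall_le_of_notMem_interior {E : Type*} [NormedAddCommGroup E]
    [NormedSpace ℝ E] [FiniteDimensional ℝ E] {C : Set E} (hC : Convex ℝ C) (hne : C.Nonempty)
    {v : E} (hv : v ∉ interior C) :
    ∃ f : E →L[ℝ] ℝ, f ≠ 0 ∧ ∀ c ∈ C, f v ≤ f c := by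
  by_cases hI : (interior C).Nonempty
  · obtain ⟨f, hf⟩ := geometric_hahn_banach_point_open hC.interior isOpen_interior hv
    refine ⟨f, ?_, fun c hc => ?_⟩
    · rintro rfl
      obtain ⟨a, ha⟩ := hI
      simpa using hf a ha
    · have hcl : c ∈ closure (interior C) := by
        rw [hC.closure_interior_eq_closure_of_nonempty_interior hI]
        exact subset_closure hc
      exact closure_minimal (t := {c | f v ≤ f c}) (fun a ha => (hf a ha).le)
        (isClosed_le continuous_const f.continuous) hcl
  -- With empty interior, `C` lies in a proper affine subspace; a functional vanishing on its
  -- direction is constant on `C`, and one of its two signs separates.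
  · obtain ⟨c₀, hc₀⟩ := hne
    have hspan : vectorSpan ℝ C ≠ ⊤ := by
      intro h
      apply hI
      rw [hC.interior_nonempty_iff_affineSpan_eq_top]
      exact (AffineSubspace.affineSpan_eq_top_iff_vectorSpan_eq_top_of_nonempty ℝ E E
        ⟨c₀, hc₀⟩).2 h
    obtain ⟨f, hf0, hf⟩ := Submodule.exists_le_ker_of_lt_top _ (lt_top_iff_ne_top.2 hspan)
    have hconst : ∀ c ∈ C, f c = f c₀ := fun c hc => by
      have h : f (c - c₀) = 0 := hf (vsub_mem_vectorSpan ℝ hc hc₀)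
      rwa [map_sub, sub_eq_zero] at h
    have hF : (LinearMap.toContinuousLinearMap f) ≠ 0 := by
      simpa using hf0
    rcases le_total (f v) (f c₀) with h | h
    · exact ⟨LinearMap.toContinuousLinearMap f, hF, fun c hc => by simpa [hconst c hc] using h⟩
    · exact ⟨-LinearMap.toContinuousLinearMap f, neg_ne_zero.2 hF,
        fun c hc => by simpa [hconst c hc] using h⟩

theorem clm_pi_apply_eq_sum {ι : Type*} [Fintype ι] [DecidableEq ι] (f : (ι → ℝ) →L[ℝ] ℝ)
    (u : ι → ℝ) : f u = ∑ i, f (Pi.single i 1) * u i := by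
  have h := LinearMap.pi_apply_eq_sum_univ (f : (ι → ℝ) →ₗ[ℝ] ℝ) u
  simp only [ContinuousLinearMap.coe_coe, smul_eq_mul] at h
  rw [h]
  refine Finset.sum_congr rfl fun i _ => ?_
  rw [mul_comm]
  congr 2
  ext j
  simp [Pi.single_apply, eq_comm]

theorem exists_normal_of_notMem_interior_pi {ι : Type*} [Fintype ι] {C : Set (ι → ℝ)}
    (hC : Convex ℝ C) (hne : C.Nonempty) {v : ι → ℝ} (hv : v ∉ interior C) :
    ∃ π : ι → ℝ, π ≠ 0 ∧ ∀ c ∈ C, ∑ i, π i * v i ≤ ∑ i, π i * c i := by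
  classical
  obtain ⟨f, hf0, hf⟩ := exists_ne_zero_forall_le_of_notMem_interior hC hne hv
  refine ⟨fun i => f (Pi.single i 1), fun h => hf0 ?_, fun c hc => ?_⟩
  · ext u
    rw [clm_pi_apply_eq_sum]
    exact Finset.sum_eq_zero fun i _ => by rw [show f (Pi.single i 1) = 0 from congrFun h i, zero_mul]
  · simpa only [← clm_pi_apply_eq_sum] using hf c hc

theorem exists_normal_of_zero_notMem_interior_prod {ι κ : Type*} [Fintype ι] [Fintype κ]
    {C : Set ((ι → ℝ) × (κ → ℝ))} (hC : Convex ℝ C) (hne : C.Nonempty) (hv : 0 ∉ interior C) :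
    ∃ (ξ : ι → ℝ) (π : κ → ℝ), (ξ ≠ 0 ∨ π ≠ 0) ∧
      ∀ u v, (u, v) ∈ C → 0 ≤ ∑ i, ξ i * u i + ∑ j, π j * v j := by
  classical
  obtain ⟨f, hf0, hf⟩ := exists_ne_zero_forall_le_of_notMem_interior hC hne hv
  have key : ∀ u v, f (u, v) = ∑ i, f (Pi.single i 1, 0) * u i + ∑ j, f (0, Pi.single j 1) * v j := by
    intro u v
    have h1 := clm_pi_apply_eq_sum (f.comp (ContinuousLinearMap.inl ℝ (ι → ℝ) (κ → ℝ))) u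
    have h2 := clm_pi_apply_eq_sum (f.comp (ContinuousLinearMap.inr ℝ (ι → ℝ) (κ → ℝ))) v
    simp only [ContinuousLinearMap.comp_apply, ContinuousLinearMap.inl_apply,
      ContinuousLinearMap.inr_apply] at h1 h2
    rw [← h1, ← h2, ← map_add]
    simp
  refine ⟨fun i => f (Pi.single i 1, 0), fun j => f (0, Pi.single j 1), ?_, fun u v huv => ?_⟩
  · by_contra! h
    apply hf0
    refine ContinuousLinearMap.ext fun w => ?_
    rw [← Prod.mk.eta (p := w), key]
    have h1 : ∀ i, f (Pi.single i 1, 0) = 0 := fun i => congrFun h.1 i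
    have h2 : ∀ j, f (0, Pi.single j 1) = 0 := fun j => congrFun h.2 j
    simp [h1, h2]
  · rw [← key]
    simpa using hf _ huv

/-- A convex set that comes within `r / 2` of all points `r σ`, `σ` a vector of signs, contains
the cube of radius `r / 4`. -/
theorem mem_of_forall_sign {p : ℕ} {C : Set (Fin p → ℝ)} (hC : Convex ℝ C) {r : ℝ} (hr : 0 < r)
    (hσ : ∀ σ : Fin p → SignType, ∃ c ∈ C, ∀ j, |c j - r * (σ j : ℝ)| ≤ r / 2)
    {v : Fin p → ℝ} (hv : ∀ j, |v j| ≤ r / 4) : v ∈ C := by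
  by_contra hvC
  obtain ⟨c₀, hc₀, -⟩ := hσ 0
  obtain ⟨π, hπ0, hπ⟩ := exists_normal_of_notMem_interior_pi hC ⟨c₀, hc₀⟩
    (fun h => hvC (interior_subset h))
  -- With signs opposite to `π`, the pairing of `π` with `c` is at most `-(r / 2) ∑ |π j|`, while
  -- its pairing with `v` is at least `-(r / 4) ∑ |π j|`; this contradicts the separation.
  obtain ⟨c, hc, hcσ⟩ := hσ fun j => -SignType.sign (π j)
  have h1 := hπ c hc
  have hpos : 0 < ∑ j, |π j| := by
    obtain ⟨j, hj⟩ := Function.ne_iff.1 hπ0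
    exact Finset.sum_pos' (fun j _ => abs_nonneg _) ⟨j, Finset.mem_univ j, abs_pos.2 hj⟩
  have h2 : ∑ j, π j * c j ≤ ∑ j, -(r / 2) * |π j| := by
    refine Finset.sum_le_sum fun j _ => ?_
    have h3 := hcσ j
    have h4 : π j * (c j - r * ((-SignType.sign (π j) : SignType) : ℝ)) ≤ |π j| * (r / 2) :=
      (le_abs_self _).trans (by rw [abs_mul]; gcongr)
    have h5 : π j * (SignType.sign (π j) : ℝ) = |π j| := self_mul_sign _
    have h6 : ((-SignType.sign (π j) : SignType) : ℝ) = -(SignType.sign (π j) : ℝ) := by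
      cases SignType.sign (π j) <;> simp
    rw [h6] at h4
    linear_combination h4 - r * h5
  have h3 : ∑ j, -(r / 4) * |π j| ≤ ∑ j, π j * v j := by
    refine Finset.sum_le_sum fun j _ => ?_
    have h4 : -(|π j| * (r / 4)) ≤ π j * v j :=
      (neg_le_neg (by rw [abs_mul]; gcongr; exact hv j)).trans (neg_abs_le (π j * v j))
    linarith
  rw [← Finset.mul_sum] at h2 h3
  nlinarith

end Separation

/-! ### Lipschitz bounds on compact sets -/

section Lipschitz

theorem exists_lipschitz_bound {α E : Type*} [PseudoMetricSpace α] [SeminormedAddCommGroup E]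
    {f : α → E} {s t : Set α} (hf : LocallyLipschitzOn s f) (ht : IsCompact t) (hts : t ⊆ s) :
    ∃ L : ℝ, 0 ≤ L ∧ ∀ a ∈ t, ∀ b ∈ t, ‖f a - f b‖ ≤ L * dist a b := by
  obtain ⟨L, hL⟩ := (hf.mono hts).exists_lipschitzOnWith_of_compact ht
  exact ⟨L, L.2, fun a ha b hb => by simpa [dist_eq_norm] using hL.dist_le_mul a ha b hb⟩

theorem exists_common_bound {ι : Type*} [Finite ι] {q : ι → ℝ → Prop}
    (hq : ∀ i, ∀ L L', L ≤ L' → q i L → q i L') (h : ∀ i, ∃ L, 0 ≤ L ∧ q i L) :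
    ∃ L, 0 ≤ L ∧ ∀ i, q i L := by
  have := Fintype.ofFinite ι
  choose L hL0 hL using h
  exact ⟨∑ i, L i, Finset.sum_nonneg fun i _ => hL0 i, fun i =>
    hq i _ _ (Finset.single_le_sum (fun i _ => hL0 i) (Finset.mem_univ i)) (hL i)⟩

theorem locallyLipschitzOn_of_contDiffOn {E F : Type*} [NormedAddCommGroup E] [NormedSpace ℝ E]
    [NormedAddCommGroup F] [NormedSpace ℝ F] {f : E → F} {U : Set E} (hU : IsOpen U)
    (hf : ContDiffOn ℝ 1 f U) : LocallyLipschitzOn U f := by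
  intro x hx
  obtain ⟨L, t, ht, hL⟩ := (hf.contDiffAt (hU.mem_nhds hx)).exists_lipschitzOnWith
  exact ⟨L, t, mem_nhdsWithin_of_mem_nhds ht, hL⟩

end Lipschitz

/-! ### The maximum norm and steps into a convex set -/

section InfNorm

variable {n : ℕ}

theorem infNorm_zero : infNorm (0 : Vec n) = 0 := by simp [infNorm]

theorem infNorm_add_le (v w : Vec n) : infNorm (v + w) ≤ infNorm v + infNorm w := by
  simpa [infNorm] using norm_add_le (WithLp.ofLp v) (WithLp.ofLp w)

theorem infNorm_smul (t : ℝ) (v : Vec n) : infNorm (t • v) = |t| * infNorm v := by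
  simp [infNorm, norm_smul]

theorem infNorm_le_norm (v : Vec n) : infNorm v ≤ ‖v‖ := by
  refine (pi_norm_le_iff_of_nonneg (norm_nonneg v)).2 fun i => ?_
  exact PiLp.norm_apply_le v i

theorem infNorm_le_iff {v : Vec n} {r : ℝ} (hr : 0 ≤ r) : infNorm v ≤ r ↔ ∀ i, |v i| ≤ r := by
  simp [infNorm, pi_norm_le_iff_of_nonneg hr]

theorem isCompact_infNorm_le (r : ℝ) : IsCompact {v : Vec n | infNorm v ≤ r} := by
  have h := (PiLp.continuousLinearEquiv 2 ℝ (fun _ : Fin n => ℝ)).toHomeomorph.isCompact_preimage.2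
    (isCompact_closedBall (0 : Fin n → ℝ) r)
  convert h using 1
  ext v
  rw [Set.mem_preimage, mem_closedBall_zero_iff]
  exact Iff.rfl

theorem exists_norm_le_of_infNorm_le (r : ℝ) :
    ∃ R : ℝ, 0 ≤ R ∧ ∀ v : Vec n, infNorm v ≤ r → ‖v‖ ≤ R := by
  obtain ⟨R, hR⟩ := (isCompact_infNorm_le (n := n) r).isBounded.exists_norm_le
  exact ⟨max R 0, le_max_right _ _, fun v hv => (hR v hv).trans (le_max_left _ _)⟩

theorem infNorm_convexCombination_le {v w : Vec n} {r t : ℝ} (ht0 : 0 ≤ t) (ht1 : t ≤ 1)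
    (hv : infNorm v ≤ r) (hw : infNorm w ≤ r) : infNorm ((1 - t) • v + t • w) ≤ r := by
  refine (infNorm_add_le _ _).trans ?_
  rw [infNorm_smul, infNorm_smul, abs_of_nonneg ht0, abs_of_nonneg (sub_nonneg.2 ht1)]
  nlinarith

/-- A step from `y` into the convex set `K` can be turned into a step of the same size from
`z ∈ K` by a change of the order of `‖y - z‖`. -/
theorem exists_shifted_step {K : Set (Vec n)} (hK : Convex ℝ K) {y z d : Vec n} (hz : z ∈ K)
    {r : ℝ} (hr : 0 < r) (hd : infNorm d ≤ r) (hyd : y + d ∈ K) :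
    ∃ e, infNorm e ≤ r ∧ z + e ∈ K ∧ ‖e - d‖ ≤ (1 + ‖d‖ / r) * ‖y - z‖ := by
  set δ := ‖y - z‖ with hδ
  have hδ0 : 0 ≤ δ := norm_nonneg _
  set t := δ / (r + δ) with ht
  have hrδ : 0 < r + δ := by linarith
  have ht0 : 0 ≤ t := by positivity
  have h1t : 1 - t = r / (r + δ) := by rw [ht]; field_simp; ring
  have h1t0 : 0 ≤ 1 - t := by rw [h1t]; positivity
  have htr : t ≤ δ / r := by rw [ht]; gcongr; linarith
  -- The step `d + (y - z)` leads from `z` to `y + d` but may have size `r + δ`; the factor `1 - t =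
  -- r / (r + δ)` restores the size `r`, and the endpoint stays on the segment from `z` to `y + d`.
  refine ⟨(1 - t) • (d + (y - z)), ?_, ?_, ?_⟩
  · rw [infNorm_smul, abs_of_nonneg h1t0, h1t]
    have : infNorm (d + (y - z)) ≤ r + δ :=
      (infNorm_add_le _ _).trans (add_le_add hd (infNorm_le_norm _))
    calc r / (r + δ) * infNorm (d + (y - z)) ≤ r / (r + δ) * (r + δ) := by gcongr
      _ = r := by field_simp
  · have := hK hyd hz h1t0 ht0 (by ring)
    convert this using 1
    module
  · have : (1 - t) • (d + (y - z)) - d = (1 - t) • (y - z) - t • d := by module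
    rw [this]
    refine (norm_sub_le _ _).trans ?_
    rw [norm_smul, norm_smul, Real.norm_of_nonneg h1t0, Real.norm_of_nonneg ht0, ← hδ]
    have h1 : (1 - t) * δ ≤ 1 * δ := by gcongr; linarith
    have h2 : t * ‖d‖ ≤ δ / r * ‖d‖ := by gcongr
    calc _ ≤ 1 * δ + δ / r * ‖d‖ := add_le_add h1 h2
      _ = _ := by ring

end InfNorm

/-! ### The infeasibility measure -/

section Violation

variable {m p : ℕ}

theorem violation_le_iff {a : Fin m → ℝ} {b : Fin p → ℝ} {c : ℝ} :
    violation a b ≤ c ↔ 0 ≤ c ∧ (∀ i, a i ≤ c) ∧ ∀ j, |b j| ≤ c := by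
  constructor
  · intro h
    have hc : 0 ≤ c := (norm_nonneg b).trans ((le_max_right _ _).trans h)
    obtain ⟨h1, h2⟩ := max_le_iff.1 h
    rw [pi_norm_le_iff_of_nonneg hc] at h1 h2
    refine ⟨hc, fun i => ?_, h2⟩
    exact (le_max_left _ 0).trans ((le_abs_self _).trans (h1 i))
  · rintro ⟨hc, h1, h2⟩
    refine max_le ((pi_norm_le_iff_of_nonneg hc).2 fun i => ?_)
      ((pi_norm_le_iff_of_nonneg hc).2 h2)
    rw [Real.norm_of_nonneg (le_max_right _ _)]
    exact max_le (h1 i) hc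

theorem violation_nonneg (a : Fin m → ℝ) (b : Fin p → ℝ) : 0 ≤ violation a b :=
  (violation_le_iff.1 le_rfl).1

theorem le_violation_left (a : Fin m → ℝ) (b : Fin p → ℝ) (i : Fin m) : a i ≤ violation a b :=
  (violation_le_iff.1 le_rfl).2.1 i

theorem abs_le_violation_right (a : Fin m → ℝ) (b : Fin p → ℝ) (j : Fin p) :
    |b j| ≤ violation a b :=
  (violation_le_iff.1 le_rfl).2.2 j

theorem violation_le_add {a a' : Fin m → ℝ} {b b' : Fin p → ℝ} {ε : ℝ} (hε : 0 ≤ ε)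
    (ha : ∀ i, |a i - a' i| ≤ ε) (hb : ∀ j, |b j - b' j| ≤ ε) :
    violation a b ≤ violation a' b' + ε := by
  refine violation_le_iff.2 ⟨add_nonneg (violation_nonneg _ _) hε, fun i => ?_, fun j => ?_⟩
  · linarith [(abs_le.1 (ha i)).2, le_violation_left a' b' i]
  · have := abs_sub_abs_le_abs_sub (b j) (b' j)
    linarith [hb j, abs_le_violation_right a' b' j]

theorem continuousOn_violation {X : Type*} [TopologicalSpace X] {s : Set X}
    {a : Fin m → X → ℝ} {b : Fin p → X → ℝ} (ha : ∀ i, ContinuousOn (a i) s)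
    (hb : ∀ j, ContinuousOn (b j) s) :
    ContinuousOn (fun x => violation (fun i => a i x) (fun j => b j x)) s := by
  unfold violation
  refine ContinuousOn.sup (ContinuousOn.norm ?_) (ContinuousOn.norm ?_)
  · exact continuousOn_pi.2 fun i => (ha i).sup continuousOn_const
  · exact continuousOn_pi.2 hb

end Violation

end GhostPenalty

/-! ### Well-posedness of the subproblem and Lipschitz dependence of its data -/

namespace GhostPenalty
namespace Problem

variable {n m p : ℕ} {P : Problem n m p} {T : Surrogate n m} {Od Ox : Set (Vec n)}

/-- The infeasibility of the step `d` with respect to the surrogate constraints at `x`. -/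
def stepViolation (P : Problem n m p) (T : Surrogate n m) (d x : Vec n) : ℝ :=
  violation (fun i => T.gt i d x) (fun j => P.ht j d x)

/-- The least surrogate infeasibility of a step of size at most `ρ` that stays in `K`. -/
def minViolation (P : Problem n m p) (T : Surrogate n m) (x : Vec n) : ℝ :=
  sInf ((fun d => P.stepViolation T d x) '' {d | infNorm d ≤ T.ρ ∧ x + d ∈ P.K})

theorem kappa_eq (P : Problem n m p) (T : Surrogate n m) (x : Vec n) :
    P.kappa T x = (1 - T.lam) * P.phi x + T.lam * P.minViolation T x := rfl

theorem ht_zero (j : Fin p) (x : Vec n) : P.ht j 0 x = P.h j x := by simp [ht]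

theorem ht_convexCombination (j : Fin p) (x d e : Vec n) (t : ℝ) :
    P.ht j ((1 - t) • d + t • e) x = (1 - t) * P.ht j d x + t * P.ht j e x := by
  simp only [ht, inner_add_right, inner_smul_right]
  ring

theorem stepViolation_zero (hA : T.Admissible P Od Ox) {x : Vec n} (hx : x ∈ P.K) :
    P.stepViolation T 0 x = P.phi x := by
  unfold stepViolation phi
  congr 1
  · funext i; exact hA.gt_zero i x hx
  · funext j; exact ht_zero j x

theorem beta_pos (hA : T.Admissible P Od Ox) : 0 < T.β := hA.rho_pos.trans hA.rho_lt_beta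

theorem gt_convexCombination_le (hA : T.Admissible P Od Ox) (i : Fin m) {x d e : Vec n}
    (hx : x ∈ P.K) (hd : infNorm d ≤ T.β) (he : infNorm e ≤ T.β) {t : ℝ} (ht0 : 0 ≤ t)
    (ht1 : t ≤ 1) :
    T.gt i ((1 - t) • d + t • e) x ≤ (1 - t) * T.gt i d x + t * T.gt i e x :=
  (hA.gt_convexOn i x hx).2 (hA.ball_subset_Od hd) (hA.ball_subset_Od he) (sub_nonneg.2 ht1) ht0
    (by ring)

theorem continuous_gt (hA : T.Admissible P Od Ox) (i : Fin m) {x : Vec n} (hx : x ∈ P.K) :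
    Continuous fun d => T.gt i d x := by
  rw [← continuousOn_univ]
  exact (hA.gt_continuousOn i).comp (f := fun d => (d, x)) (by fun_prop)
    fun d _ => ⟨trivial, hA.K_subset_Ox hx⟩

theorem continuous_ht (j : Fin p) (x : Vec n) : Continuous fun d => P.ht j d x := by
  unfold ht; fun_prop

theorem isCompact_steps (hP : P.Regular) (r : ℝ) (x : Vec n) :
    IsCompact {d : Vec n | infNorm d ≤ r ∧ x + d ∈ P.K} :=
  (isCompact_infNorm_le r).inter_right (hP.isClosed_K.preimage (continuous_const_add x))

theorem exists_minViolation_eq (hP : P.Regular) (hA : T.Admissible P Od Ox) {x : Vec n}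
    (hx : x ∈ P.K) :
    ∃ d, infNorm d ≤ T.ρ ∧ x + d ∈ P.K ∧ P.stepViolation T d x = P.minViolation T x := by
  obtain ⟨d, hd, heq⟩ := (isCompact_steps hP T.ρ x).exists_sInf_image_eq
    ⟨0, by simpa [infNorm_zero] using hA.rho_pos.le, by simpa using hx⟩
    (f := fun d => P.stepViolation T d x)
    (continuousOn_violation (fun i => (continuous_gt hA i hx).continuousOn)
      fun j => (continuous_ht j x).continuousOn)
  exact ⟨d, hd.1, hd.2, heq.symm⟩

theorem minViolation_le {x d : Vec n} (hd : infNorm d ≤ T.ρ) (hxd : x + d ∈ P.K) :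
    P.minViolation T x ≤ P.stepViolation T d x := by
  refine csInf_le ⟨0, ?_⟩ ⟨d, ⟨hd, hxd⟩, rfl⟩
  rintro _ ⟨e, -, rfl⟩
  exact violation_nonneg _ _

theorem minViolation_le_phi (hA : T.Admissible P Od Ox) {x : Vec n} (hx : x ∈ P.K) :
    P.minViolation T x ≤ P.phi x := by
  rw [← stepViolation_zero hA hx]
  exact minViolation_le (by simpa [infNorm_zero] using hA.rho_pos.le) (by simpa using hx)

/-- `kappa` is an average of `phi` and `minViolation`, and the latter is the smaller of the two.
This is what makes the subproblem feasible. -/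
theorem minViolation_le_kappa (hA : T.Admissible P Od Ox) {x : Vec n} (hx : x ∈ P.K) :
    P.minViolation T x ≤ P.kappa T x := by
  rw [kappa_eq]
  nlinarith [minViolation_le_phi hA hx, hA.lam_lt_one]

theorem kappa_nonneg (hP : P.Regular) (hA : T.Admissible P Od Ox) {x : Vec n} (hx : x ∈ P.K) :
    0 ≤ P.kappa T x := by
  obtain ⟨d, -, -, hd⟩ := exists_minViolation_eq hP hA hx
  exact (hd ▸ violation_nonneg _ _ : 0 ≤ P.minViolation T x).trans (minViolation_le_kappa hA hx)

theorem mem_subFeasible_iff {x d : Vec n} :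
    d ∈ P.subFeasible T x ↔ (∀ i, T.gt i d x ≤ P.kappa T x) ∧
      (∀ j, |P.ht j d x| ≤ P.kappa T x) ∧ infNorm d ≤ T.β ∧ x + d ∈ P.K := by
  simp only [abs_le]; exact Iff.rfl

theorem subFeasible_nonempty (hP : P.Regular) (hA : T.Admissible P Od Ox) {x : Vec n}
    (hx : x ∈ P.K) : (P.subFeasible T x).Nonempty := by
  obtain ⟨d, hd, hxd, heq⟩ := exists_minViolation_eq hP hA hx
  obtain ⟨-, h1, h2⟩ := violation_le_iff.1 (heq.le.trans (minViolation_le_kappa hA hx))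
  exact ⟨d, mem_subFeasible_iff.2 ⟨h1, h2, hd.trans hA.rho_lt_beta.le, hxd⟩⟩

theorem isCompact_subFeasible (hP : P.Regular) (hA : T.Admissible P Od Ox) {x : Vec n}
    (hx : x ∈ P.K) : IsCompact (P.subFeasible T x) := by
  have : P.subFeasible T x = {d : Vec n | infNorm d ≤ T.β ∧ x + d ∈ P.K} ∩
      ((⋂ i, {d | T.gt i d x ≤ P.kappa T x}) ∩ ⋂ j, {d | |P.ht j d x| ≤ P.kappa T x}) := by
    ext d
    simp only [mem_subFeasible_iff, Set.mem_inter_iff, Set.mem_iInter, Set.mem_ofPred_eq]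
    tauto
  rw [this]
  exact (isCompact_steps hP _ x).inter_right
    ((isClosed_iInter fun i => isClosed_le (continuous_gt hA i hx) continuous_const).inter
      (isClosed_iInter fun j => isClosed_le (continuous_ht j x).abs continuous_const))

theorem convex_subFeasible (hP : P.Regular) (hA : T.Admissible P Od Ox) {x d e : Vec n}
    (hx : x ∈ P.K) (hd : d ∈ P.subFeasible T x) (he : e ∈ P.subFeasible T x) {t : ℝ}
    (ht0 : 0 ≤ t) (ht1 : t ≤ 1) : (1 - t) • d + t • e ∈ P.subFeasible T x := by
  rw [mem_subFeasible_iff] at *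
  obtain ⟨hd1, hd2, hd3, hd4⟩ := hd
  obtain ⟨he1, he2, he3, he4⟩ := he
  refine ⟨fun i => ?_, fun j => ?_, infNorm_convexCombination_le ht0 ht1 hd3 he3, ?_⟩
  · refine (gt_convexCombination_le hA i hx hd3 he3 ht0 ht1).trans ?_
    nlinarith [hd1 i, he1 i]
  · rw [ht_convexCombination, abs_le]
    have h1 := abs_le.1 (hd2 j)
    have h2 := abs_le.1 (he2 j)
    constructor <;> nlinarith
  · have := hP.convex_K hd4 he4 (sub_nonneg.2 ht1) ht0 (by ring)
    convert this using 1
    module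

/-- The objective function of the subproblem. -/
def subObjective (P : Problem n m p) (T : Surrogate n m) (x d : Vec n) : ℝ :=
  T.ft d x + P.q (x + d)

theorem subObjective_midpoint_le {c : ℝ}
    (hA : T.Admissible P Od Ox) (hP : P.Regular)
    (hc : ∀ x ∈ P.K, StrongConvexOn Od c fun d => T.ft d x) {x d e : Vec n} (hx : x ∈ P.K)
    (hd : infNorm d ≤ T.β) (hxd : x + d ∈ P.K) (he : infNorm e ≤ T.β) (hxe : x + e ∈ P.K) :
    P.subObjective T x ((1 - (1 / 2 : ℝ)) • d + (1 / 2 : ℝ) • e) ≤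
      (P.subObjective T x d + P.subObjective T x e) / 2 - c / 8 * ‖e - d‖ ^ 2 := by
  have hsc : UniformConvexOn Od (fun r => c / (2 : ℝ) * r ^ 2) fun d => T.ft d x := hc x hx
  have h1 := hsc.2 (hA.ball_subset_Od hd) (hA.ball_subset_Od he)
    (show (0 : ℝ) ≤ 1 - 1 / 2 by norm_num) (show (0 : ℝ) ≤ 1 / 2 by norm_num) (by norm_num)
  have h2 := hP.q_convexOn.2 hxd hxe
    (show (0 : ℝ) ≤ 1 - 1 / 2 by norm_num) (show (0 : ℝ) ≤ 1 / 2 by norm_num) (by norm_num)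
  have h3 : (1 - (1 / 2 : ℝ)) • (x + d) + (1 / 2 : ℝ) • (x + e) =
      x + ((1 - (1 / 2 : ℝ)) • d + (1 / 2 : ℝ) • e) := by module
  rw [h3] at h2
  simp only [smul_eq_mul] at h1 h2
  rw [norm_sub_rev] at h1
  unfold subObjective
  linarith

/-- The midpoint of `d` and `e` is feasible, so its objective value is no less than that at `d`;
doubling the midpoint gain `c / 8` leaves `c / 4`. -/
theorem isSubSolution_quadratic_growth {c : ℝ}
    (hP : P.Regular) (hA : T.Admissible P Od Ox)
    (hc : ∀ x ∈ P.K, StrongConvexOn Od c fun d => T.ft d x) {x d e : Vec n} (hx : x ∈ P.K)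
    (hd : P.IsSubSolution T x d) (he : e ∈ P.subFeasible T x) :
    P.subObjective T x d + c / 4 * ‖e - d‖ ^ 2 ≤ P.subObjective T x e := by
  have hm := subObjective_midpoint_le hA hP hc hx hd.1.2.2.1 hd.1.2.2.2 he.2.2.1 he.2.2.2
  have hmin : P.subObjective T x d ≤ _ :=
    hd.2 (convex_subFeasible hP hA hx hd.1 he (by norm_num : (0 : ℝ) ≤ 1 / 2) (by norm_num))
  have := hmin.trans hm
  linarith

theorem exists_isSubSolution (hP : P.Regular) (hA : T.Admissible P Od Ox) {x : Vec n}
    (hx : x ∈ P.K) : ∃ d, P.IsSubSolution T x d := by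
  have hcont : ContinuousOn (fun e => T.ft e x + P.q (x + e)) (P.subFeasible T x) := by
    refine ContinuousOn.add ?_ ?_
    · exact hA.ft_continuousOn.comp (f := fun d => (d, x)) (by fun_prop)
        fun d hd => ⟨hA.ball_subset_Od hd.2.2.1, hA.K_subset_Ox hx⟩
    · obtain ⟨U, -, hKU, hq⟩ := hP.q_locallyLipschitz
      exact hq.continuousOn.comp (f := fun d => x + d) (by fun_prop) fun d hd => hKU hd.2.2.2
  obtain ⟨d, hd, hmin⟩ := (isCompact_subFeasible hP hA hx).exists_isMinOn
    (subFeasible_nonempty hP hA hx) hcont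
  exact ⟨d, hd, hmin⟩

theorem existsUnique_isSubSolution (hP : P.Regular) (hA : T.Admissible P Od Ox) {x : Vec n}
    (hx : x ∈ P.K) : ∃! d, P.IsSubSolution T x d := by
  obtain ⟨d, hd⟩ := exists_isSubSolution hP hA hx
  refine ⟨d, hd, fun e he => ?_⟩
  obtain ⟨c, hc0, hc⟩ := hA.ft_strongConvexOn
  have h1 := isSubSolution_quadratic_growth hP hA hc hx hd he.1
  have h2 : P.subObjective T x e ≤ P.subObjective T x d := he.2 hd.1
  have h3 : ‖e - d‖ ^ 2 ≤ 0 := by nlinarith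
  have h4 : ‖e - d‖ = 0 := by nlinarith [norm_nonneg (e - d)]
  exact sub_eq_zero.1 (norm_eq_zero.1 h4)

theorem isSubSolution_solutionMap (hP : P.Regular) (hA : T.Admissible P Od Ox) {x : Vec n}
    (hx : x ∈ P.K) : P.IsSubSolution T x (P.solutionMap T x) :=
  Classical.epsilon_spec (exists_isSubSolution hP hA hx)

section Lipschitz

variable {S : Set (Vec n)}

theorem exists_lipschitz_joint {ι : Type*} [Finite ι] {F : ι → Vec n → Vec n → ℝ}
    (hA : T.Admissible P Od Ox) (hS : IsCompact S) (hSK : S ⊆ P.K)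
    (hF : ∀ i, LocallyLipschitzOn (Od ×ˢ Ox) fun z : Vec n × Vec n => F i z.1 z.2) :
    ∃ L : ℝ, 0 ≤ L ∧ ∀ i, ∀ d e, infNorm d ≤ T.β → infNorm e ≤ T.β → ∀ y ∈ S, ∀ z ∈ S,
      |F i d y - F i e z| ≤ L * (‖d - e‖ + ‖y - z‖) := by
  refine exists_common_bound (fun i L L' hLL h d e hd he y hy z hz => ?_) fun i => ?_
  · refine (h d e hd he y hy z hz).trans ?_
    gcongr
  · obtain ⟨L, hL0, hL⟩ := exists_lipschitz_bound (hF i)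
      ((isCompact_infNorm_le T.β).prod hS)
      (Set.prod_mono hA.ball_subset_Od (hSK.trans hA.K_subset_Ox))
    refine ⟨L, hL0, fun d e hd he y hy z hz => ?_⟩
    have h := hL (d, y) ⟨hd, hy⟩ (e, z) ⟨he, hz⟩
    rw [Real.norm_eq_abs, Prod.dist_eq] at h
    refine h.trans ?_
    gcongr
    simp only [dist_eq_norm]
    exact max_le_add_of_nonneg (norm_nonneg _) (norm_nonneg _)

/-- The change splits into that of `h`, that of the gradient against the bounded step `d`, and a
bounded gradient against `d - e`; the second term needs the gradient to be locally Lipschitz. -/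
theorem exists_lipschitz_ht (hP : P.Regular) (hS : IsCompact S) (hSK : S ⊆ P.K) :
    ∃ L : ℝ, 0 ≤ L ∧ ∀ j, ∀ d e, infNorm d ≤ T.β → infNorm e ≤ T.β → ∀ y ∈ S, ∀ z ∈ S,
      |P.ht j d y - P.ht j e z| ≤ L * (‖d - e‖ + ‖y - z‖) := by
  refine exists_common_bound (fun j L L' hLL h d e hd he y hy z hz => ?_) fun j => ?_
  · refine (h d e hd he y hy z hz).trans ?_
    gcongr
  · obtain ⟨U, hU, hKU, hh, hgrad⟩ := hP.h_C11 j
    obtain ⟨L₁, hL₁0, hL₁⟩ := exists_lipschitz_bound (locallyLipschitzOn_of_contDiffOn hU hh) hS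
      (hSK.trans hKU)
    obtain ⟨L₂, hL₂0, hL₂⟩ := exists_lipschitz_bound hgrad hS (hSK.trans hKU)
    obtain ⟨G, hG⟩ := hS.exists_bound_of_continuousOn (hgrad.continuousOn.mono (hSK.trans hKU))
    obtain ⟨R, hR0, hR⟩ := exists_norm_le_of_infNorm_le (n := n) T.β
    refine ⟨L₁ + L₂ * R + |G|, by positivity, fun d e hd he y hy z hz => ?_⟩
    have h1 := hL₁ y hy z hz
    have h2 := hL₂ y hy z hz
    rw [dist_eq_norm] at h1 h2
    have h3 : |inner ℝ (∇ (P.h j) y - ∇ (P.h j) z) d| ≤ L₂ * ‖y - z‖ * R :=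
      (abs_real_inner_le_norm _ _).trans (by gcongr; exact hR d hd)
    have h4 : |inner ℝ (∇ (P.h j) z) (d - e)| ≤ |G| * ‖d - e‖ :=
      (abs_real_inner_le_norm _ _).trans (by gcongr; exact (hG z hz).trans (le_abs_self G))
    have h5 : P.ht j d y - P.ht j e z = (P.h j y - P.h j z) +
        inner ℝ (∇ (P.h j) y - ∇ (P.h j) z) d + inner ℝ (∇ (P.h j) z) (d - e) := by
      simp only [ht, inner_sub_left, inner_sub_right]; ring
    rw [h5]
    refine (abs_add_three _ _ _).trans ((add_le_add_three h1 h3 h4).trans ?_)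
    have := norm_nonneg (d - e)
    have := norm_nonneg (y - z)
    have : 0 ≤ (L₁ + L₂ * R) * ‖d - e‖ := by positivity
    have : 0 ≤ |G| * ‖y - z‖ := by positivity
    linarith

theorem exists_lipschitz_q (hP : P.Regular) (hS : IsCompact S) (r : ℝ) :
    ∃ L : ℝ, 0 ≤ L ∧ ∀ d e, infNorm d ≤ r → infNorm e ≤ r → ∀ y ∈ S, ∀ z ∈ S,
      y + d ∈ P.K → z + e ∈ P.K → |P.q (y + d) - P.q (z + e)| ≤ L * (‖d - e‖ + ‖y - z‖) := by
  obtain ⟨U, -, hKU, hq⟩ := hP.q_locallyLipschitz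
  obtain ⟨L, hL0, hL⟩ := exists_lipschitz_bound hq
    ((hS.add (isCompact_infNorm_le r)).inter_right hP.isClosed_K)
    (Set.inter_subset_right.trans hKU)
  refine ⟨L, hL0, fun d e hd he y hy z hz hyd hze => ?_⟩
  refine (hL _ ⟨Set.add_mem_add hy hd, hyd⟩ _ ⟨Set.add_mem_add hz he, hze⟩).trans ?_
  gcongr
  rw [dist_eq_norm, show y + d - (z + e) = (d - e) + (y - z) by abel]
  exact norm_add_le _ _

theorem exists_lipschitz_stepViolation (hP : P.Regular) (hA : T.Admissible P Od Ox)
    (hC : T.LocallyLipschitz Od Ox) (hS : IsCompact S) (hSK : S ⊆ P.K) :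
    ∃ L : ℝ, 0 ≤ L ∧ (∀ i, ∀ d e, infNorm d ≤ T.β → infNorm e ≤ T.β → ∀ y ∈ S, ∀ z ∈ S,
        |T.gt i d y - T.gt i e z| ≤ L * (‖d - e‖ + ‖y - z‖)) ∧
      (∀ j, ∀ d e, infNorm d ≤ T.β → infNorm e ≤ T.β → ∀ y ∈ S, ∀ z ∈ S,
        |P.ht j d y - P.ht j e z| ≤ L * (‖d - e‖ + ‖y - z‖)) ∧
      ∀ y ∈ S, ∀ z ∈ S, |P.kappa T y - P.kappa T z| ≤ L * ‖y - z‖ := by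
  obtain ⟨L₁, hL₁0, hL₁⟩ := exists_lipschitz_joint hA hS hSK hC.gt_locallyLipschitz
  obtain ⟨L₂, hL₂0, hL₂⟩ := exists_lipschitz_ht (T := T) hP hS hSK
  obtain ⟨R, hR0, hR⟩ := exists_norm_le_of_infNorm_le (n := n) T.β
  have hρ := hA.rho_pos
  set M := max L₁ L₂ with hM
  have hM0 : 0 ≤ M := hL₁0.trans (le_max_left _ _)
  have hg : ∀ i, ∀ d e, infNorm d ≤ T.β → infNorm e ≤ T.β → ∀ y ∈ S, ∀ z ∈ S,
      |T.gt i d y - T.gt i e z| ≤ M * (‖d - e‖ + ‖y - z‖) := fun i d e hd he y hy z hz =>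
    (hL₁ i d e hd he y hy z hz).trans (by gcongr; exact le_max_left _ _)
  have hh : ∀ j, ∀ d e, infNorm d ≤ T.β → infNorm e ≤ T.β → ∀ y ∈ S, ∀ z ∈ S,
      |P.ht j d y - P.ht j e z| ≤ M * (‖d - e‖ + ‖y - z‖) := fun j d e hd he y hy z hz =>
    (hL₂ j d e hd he y hy z hz).trans (by gcongr; exact le_max_right _ _)
  have hv : ∀ d e, infNorm d ≤ T.β → infNorm e ≤ T.β → ∀ y ∈ S, ∀ z ∈ S,
      P.stepViolation T d y ≤ P.stepViolation T e z + M * (‖d - e‖ + ‖y - z‖) :=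
    fun d e hd he y hy z hz => violation_le_add (by positivity)
      (fun i => hg i d e hd he y hy z hz) (fun j => hh j d e hd he y hy z hz)
  -- Carrying a minimizing step over to another base point changes it by at most `(1 + R / ρ) ‖y -
  -- z‖`; the base point itself contributes one more `‖y - z‖`.
  set N := M * (2 + R / T.ρ) with hN
  have hN0 : 0 ≤ N := by positivity
  have hMN : M ≤ N := by
    have : 0 ≤ R / T.ρ := by positivity
    nlinarith
  have hphi : ∀ y ∈ S, ∀ z ∈ S, P.phi y ≤ P.phi z + N * ‖y - z‖ := by
    intro y hy z hz
    have h0 : infNorm (0 : Vec n) ≤ T.β := by rw [infNorm_zero]; exact (beta_pos hA).le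
    have h := hv 0 0 h0 h0 y hy z hz
    rw [stepViolation_zero hA (hSK hy), stepViolation_zero hA (hSK hz), sub_self, norm_zero,
      zero_add] at h
    exact h.trans (by gcongr)
  have hmin : ∀ y ∈ S, ∀ z ∈ S, P.minViolation T y ≤ P.minViolation T z + N * ‖y - z‖ := by
    intro y hy z hz
    obtain ⟨d, hd, hzd, hdeq⟩ := exists_minViolation_eq hP hA (hSK hz)
    obtain ⟨e, he, hye, hed⟩ := exists_shifted_step hP.convex_K (hSK hy) hρ hd hzd
    have hle := hA.rho_lt_beta.le
    refine (minViolation_le he hye).trans ((hv e d (he.trans hle) (hd.trans hle) y hy z hz).trans ?_)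
    rw [hdeq]
    have h1 : ‖d‖ / T.ρ ≤ R / T.ρ := by gcongr; exact hR d (hd.trans hle)
    have h2 : ‖e - d‖ + ‖y - z‖ ≤ (2 + R / T.ρ) * ‖y - z‖ := by
      rw [norm_sub_rev z y] at hed
      nlinarith [norm_nonneg (y - z)]
    rw [hN, mul_assoc]
    gcongr
  have hkap : ∀ y ∈ S, ∀ z ∈ S, P.kappa T y ≤ P.kappa T z + N * ‖y - z‖ := by
    intro y hy z hz
    rw [kappa_eq, kappa_eq]
    nlinarith [hphi y hy z hz, hmin y hy z hz, hA.lam_pos, hA.lam_lt_one]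
  refine ⟨N, hN0, fun i d e hd he y hy z hz => (hg i d e hd he y hy z hz).trans (by gcongr),
    fun j d e hd he y hy z hz => (hh j d e hd he y hy z hz).trans (by gcongr),
    fun y hy z hz => abs_le.2 ⟨?_, ?_⟩⟩
  · have := hkap z hz y hy
    rw [norm_sub_rev] at this
    linarith
  · linarith [hkap y hy z hz]

end Lipschitz

end Problem
end GhostPenalty

/-! ### From the constraint qualification to uniform regularity -/

namespace GhostPenalty
namespace Problem

variable {n m p : ℕ} {P : Problem n m p} {T : Surrogate n m} {Od Ox : Set (Vec n)}

section ConstraintQualification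

theorem le_phi (P : Problem n m p) (x : Vec n) (i : Fin m) : P.g i x ≤ P.phi x :=
  le_violation_left (fun i => P.g i x) _ i

theorem abs_h_le_phi (P : Problem n m p) (x : Vec n) (j : Fin p) : |P.h j x| ≤ P.phi x :=
  abs_le_violation_right _ (fun j => P.h j x) j

theorem phi_nonneg (P : Problem n m p) (x : Vec n) : 0 ≤ P.phi x := violation_nonneg _ _

/-- The values that the linearized constraints, relaxed by `φ(x)`, can attain on `K`. -/
def linearizedValues (P : Problem n m p) (x : Vec n) : Set ((Fin m → ℝ) × (Fin p → ℝ)) :=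
  {w | ∃ d, x + d ∈ P.K ∧ (∀ i, P.g i x - P.phi x + inner ℝ (∇ (P.g i) x) d ≤ w.1 i) ∧
    ∀ j, |P.ht j d x - w.2 j| ≤ P.phi x}

theorem convex_linearizedValues (hP : P.Regular) (x : Vec n) :
    Convex ℝ (P.linearizedValues x) := by
  rintro ⟨u, v⟩ ⟨d, hd, hu, hv⟩ ⟨u', v'⟩ ⟨e, he, hu', hv'⟩ a b ha hb hab
  obtain rfl : a = 1 - b := by linarith
  refine ⟨(1 - b) • d + b • e, ?_, fun i => ?_, fun j => ?_⟩
  · have := hP.convex_K hd he ha hb hab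
    convert this using 1
    module
  · have h1 := mul_le_mul_of_nonneg_left (hu i) ha
    have h2 := mul_le_mul_of_nonneg_left (hu' i) hb
    simp only [inner_add_right, inner_smul_right, Prod.fst_add, Prod.smul_fst, Pi.add_apply,
      Pi.smul_apply, smul_eq_mul] at h1 h2 ⊢
    linarith
  · rw [ht_convexCombination]
    have h1 := abs_le.1 (hv j)
    have h2 := abs_le.1 (hv' j)
    simp only [Prod.snd_add, Prod.smul_snd, Pi.add_apply, Pi.smul_apply, smul_eq_mul] at h1 h2 ⊢
    rw [abs_le]
    constructor <;> nlinarith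

/-- Otherwise a nonzero functional `(ξ, π)` is nonnegative on this convex set. Values attained with
`d = 0` put `ξ` and `π` in their normal cones; values attained with `d = y - x`, `y ∈ K`, put minus
the combined gradient in the normal cone of `K`. So `(ξ, π)` is a nonzero abnormal multiplier. -/
theorem zero_mem_interior_linearizedValues (hP : P.Regular) {x : Vec n} (hx : x ∈ P.K)
    (hMF : P.EMFCQ x) : 0 ∈ interior (P.linearizedValues x) := by
  have h0K : x + 0 ∈ P.K := by simpa using hx
  have hmem0 : ∀ (u : Fin m → ℝ) (b : Fin p → ℝ), (∀ i, P.g i x - P.phi x ≤ u i) →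
      (∀ j, |b j| ≤ P.phi x) → (u, fun j => P.h j x - b j) ∈ P.linearizedValues x := by
    intro u b hu hb
    exact ⟨0, h0K, fun i => by simpa using hu i, fun j => by simpa [ht_zero] using hb j⟩
  by_contra hcon
  obtain ⟨ξ, π, hne, hsep⟩ := exists_normal_of_zero_notMem_interior_prod
    (convex_linearizedValues hP x)
    ⟨_, hmem0 _ (fun j => P.h j x) (fun i => le_rfl) (abs_h_le_phi P x)⟩ hcon
  have hu : ∀ u : Fin m → ℝ, (∀ i, P.g i x - P.phi x ≤ u i) → 0 ≤ ∑ i, ξ i * u i := by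
    intro u hu
    simpa using hsep _ _ (hmem0 u (fun j => P.h j x) hu (abs_h_le_phi P x))
  have hξ : ∀ i, 0 ≤ ξ i := by
    intro i
    by_contra! hi
    set A := ∑ k, ξ k * (P.g k x - P.phi x) with hA
    have hN : 0 ≤ (|A| + 1) / -ξ i := div_nonneg (by positivity) (by linarith)
    -- The `i`-th entry is raised just enough to make the pairing with `ξ` equal to `A - (|A| + 1) <
    -- 0`.
    have h := hu (fun k => P.g k x - P.phi x + if k = i then (|A| + 1) / -ξ i else 0) fun k => by
      have : 0 ≤ if k = i then (|A| + 1) / -ξ i else 0 := by split_ifs <;> simp [hN]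
      linarith
    simp only [mul_add, Finset.sum_add_distrib, mul_ite, mul_zero, Finset.sum_ite_eq',
      Finset.mem_univ, if_true] at h
    rw [← hA] at h
    have hne := hi.ne
    have h2 : ξ i * ((|A| + 1) / -ξ i) = -(|A| + 1) := by field_simp
    rw [h2] at h
    linarith [le_abs_self A]
  have hmem : (WithLp.toLp 2 ξ, WithLp.toLp 2 π) ∈ P.abnormalMultipliers x := by
    refine ⟨⟨fun i => sub_nonpos.2 (le_phi P x i), fun u hu0 => ?_⟩,
      ⟨(infNorm_le_iff (phi_nonneg P x)).2 (abs_h_le_phi P x), fun b hb => ?_⟩,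
      -((∑ i, ξ i • ∇ (P.g i) x) + ∑ j, π j • ∇ (P.h j) x), ⟨hx, fun y hy => ?_⟩, ?_⟩
    · have h1 := hu _ fun i => le_rfl
      have h2 : ∑ i, ξ i * u i ≤ 0 :=
        Finset.sum_nonpos fun i _ => mul_nonpos_of_nonneg_of_nonpos (hξ i) (hu0 i)
      rw [inner_sub_right]
      simp only [PiLp.inner_apply, RCLike.inner_apply, conj_trivial]
      simp only [mul_comm (ξ _)] at h1 h2
      linarith
    · have h1 := hsep _ _ (hmem0 0 (fun j => b j) (fun i => sub_nonpos.2 (le_phi P x i))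
        ((infNorm_le_iff (phi_nonneg P x)).1 hb))
      simp only [Pi.zero_apply, mul_zero, Finset.sum_const_zero, zero_add, mul_sub,
        Finset.sum_sub_distrib] at h1
      rw [inner_sub_right]
      simp only [PiLp.inner_apply, RCLike.inner_apply, conj_trivial]
      simp only [mul_comm (π _)] at h1
      linarith
    · have h1 := hsep (fun i => inner ℝ (∇ (P.g i) x) (y - x))
        (fun j => inner ℝ (∇ (P.h j) x) (y - x))
        ⟨y - x, by simpa using hy, fun i => by simpa using le_phi P x i,
          fun j => by simpa [ht] using abs_h_le_phi P x j⟩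
      simp only [inner_neg_left, inner_add_left, sum_inner, real_inner_smul_left]
      linarith
    · simp
  rw [hMF] at hmem
  have h1 : WithLp.toLp 2 ξ = 0 := congrArg Prod.fst hmem
  have h2 : WithLp.toLp 2 π = 0 := congrArg Prod.snd hmem
  rcases hne with h | h
  · exact h (by simpa using h1)
  · exact h (by simpa using h2)

theorem exists_linearized_steps (hP : P.Regular) {x : Vec n} (hx : x ∈ P.K) (hMF : P.EMFCQ x) :
    ∃ r : ℝ, 0 < r ∧ ∀ σ : Fin p → SignType, ∃ d, x + d ∈ P.K ∧
      (∀ i, P.g i x + inner ℝ (∇ (P.g i) x) d ≤ P.phi x - 2 * r) ∧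
      ∀ j, |P.ht j d x - r * (σ j : ℝ)| ≤ P.phi x := by
  obtain ⟨ε, hε, hball⟩ := Metric.mem_nhds_iff.1
    (mem_interior_iff_mem_nhds.1 (zero_mem_interior_linearizedValues hP hx hMF))
  refine ⟨ε / 4, by positivity, fun σ => ?_⟩
  have hmem : ((fun _ => -(ε / 2), fun j => ε / 4 * (σ j : ℝ)) : (Fin m → ℝ) × (Fin p → ℝ)) ∈
      Metric.ball 0 ε := by
    rw [mem_ball_zero_iff]
    refine lt_of_le_of_lt (b := ε / 2) (norm_prod_le_iff.2 ⟨?_, ?_⟩) (by linarith)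
    · refine (pi_norm_le_iff_of_nonneg (by positivity)).2 fun i => ?_
      rw [norm_neg, Real.norm_of_nonneg (by positivity)]
    · refine (pi_norm_le_iff_of_nonneg (by positivity)).2 fun j => ?_
      simp only [Real.norm_eq_abs, abs_mul, abs_of_pos (show 0 < ε / 4 by positivity)]
      have : |((σ j : SignType) : ℝ)| ≤ 1 := by cases σ j <;> simp
      nlinarith
  obtain ⟨d, hd, hg, hh⟩ := hball hmem
  exact ⟨d, hd, fun i => by linarith [hg i], hh⟩

open Filter Topology in
-- First-order expansion at the zero step, where the surrogate has the value and gradient of `g i`.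
-- The error `t * r` will use up half of the slack `2 * r` of the linearized steps.
theorem eventually_gt_smul_le (hA : T.Admissible P Od Ox) {x : Vec n} (hx : x ∈ P.K) (i : Fin m)
    (d : Vec n) {r : ℝ} (hr : 0 < r) :
    ∀ᶠ t : ℝ in 𝓝[>] 0,
      T.gt i (t • d) x ≤ P.g i x + t * inner ℝ (∇ (P.g i) x) d + t * r := by
  have h0 : (0 : Vec n) ∈ Od :=
    hA.ball_subset_Od (by simpa [infNorm_zero] using (beta_pos hA).le)
  have hdiff : DifferentiableAt ℝ (fun d => T.gt i d x) 0 :=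
    ((hA.gt_contDiffOn i x (hA.K_subset_Ox hx)).contDiffAt
      (hA.isOpen_Od.mem_nhds h0)).differentiableAt one_ne_zero
  have hgrad := hdiff.hasGradientAt
  rw [hA.grad_gt_zero i x hx] at hgrad
  have hline : HasDerivAt (fun t : ℝ => T.gt i (0 + t • d) x) _ 0 :=
    hgrad.hasFDerivAt.hasLineDerivAt d
  have hlo := (hasDerivAt_iff_isLittleO.1 hline).def hr
  filter_upwards [nhdsWithin_le_nhds hlo, self_mem_nhdsWithin] with t ht htpos
  have htpos : 0 < t := htpos
  have h1 := (le_abs_self _).trans ht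
  simp only [zero_add, zero_smul, hA.gt_zero i x hx, sub_zero, InnerProductSpace.toDual_apply_apply,
    smul_eq_mul, Real.norm_of_nonneg htpos.le] at h1
  linarith

open Filter Topology in
-- A short multiple `t • d σ` stays below `phi` with slack `t * r`, and the minimizing step `e`
-- stays below `minViolation`. Weights `1 - λ` and `λ` reproduce `kappa` and keep the slack `(1 - λ)
-- * t * r`. One `t` serves all `σ` and `i`, as there are finitely many.
theorem exists_regular_steps (hP : P.Regular) (hA : T.Admissible P Od Ox) {x : Vec n}
    (hx : x ∈ P.K) (hMF : P.EMFCQ x) :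
    ∃ r : ℝ, 0 < r ∧ ∀ σ : Fin p → SignType, ∃ w, infNorm w ≤ T.ρ ∧ x + w ∈ P.K ∧
      (∀ i, T.gt i w x ≤ P.kappa T x - r) ∧
      ∀ j, |P.ht j w x - r * (σ j : ℝ)| ≤ P.kappa T x := by
  obtain ⟨r, hr, hlin⟩ := exists_linearized_steps hP hx hMF
  choose d hdK hdg hdh using hlin
  obtain ⟨e, he, hxe, hev⟩ := exists_minViolation_eq hP hA hx
  obtain ⟨-, heg, heh⟩ := violation_le_iff.1 hev.le
  have hρ := hA.rho_pos
  have hsmall : ∀ σ, ∀ᶠ t : ℝ in 𝓝[>] 0, infNorm (t • d σ) ≤ T.ρ := by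
    intro σ
    have hlim : Tendsto (fun t : ℝ => |t| * infNorm (d σ)) (𝓝 0) (𝓝 (|0| * infNorm (d σ))) :=
      (continuous_abs.mul continuous_const).tendsto 0
    rw [abs_zero, zero_mul] at hlim
    filter_upwards [nhdsWithin_le_nhds (hlim.eventually (gt_mem_nhds hρ))] with t ht
    rw [infNorm_smul]
    exact ht.le
  have hone : ∀ᶠ t : ℝ in 𝓝[>] 0, t ≤ 1 :=
    nhdsWithin_le_nhds ((gt_mem_nhds (one_pos (α := ℝ))).mono fun t ht => le_of_lt ht)
  obtain ⟨t, ⟨⟨hs, hg⟩, ht1⟩, ht0⟩ := (((eventually_all.2 hsmall).and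
    (eventually_all.2 fun σ => eventually_all.2 fun i =>
      eventually_gt_smul_le hA hx i (d σ) hr)).and hone |>.and self_mem_nhdsWithin).exists
  have ht0 : 0 < t := ht0
  have hlam0 : 0 < 1 - T.lam := sub_pos.2 hA.lam_lt_one
  have hlam1 : 1 - T.lam ≤ 1 := by linarith [hA.lam_pos]
  refine ⟨(1 - T.lam) * t * r, by positivity, fun σ =>
    ⟨(1 - (1 - T.lam)) • e + (1 - T.lam) • (t • d σ),
      infNorm_convexCombination_le hlam0.le hlam1 he (hs σ), ?_, fun i => ?_, fun j => ?_⟩⟩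
  · have h1 := hP.convex_K hx (hdK σ) (sub_nonneg.2 ht1) ht0.le (by ring)
    have h2 := hP.convex_K hxe h1 (sub_nonneg.2 hlam1) hlam0.le (by ring)
    convert h2 using 1
    module
  · have hle := hA.rho_lt_beta.le
    refine (gt_convexCombination_le hA i hx (he.trans hle) ((hs σ).trans hle) hlam0.le
      hlam1).trans ?_
    have h1 : T.gt i (t • d σ) x ≤ P.phi x - t * r := by
      have h2 := mul_le_mul_of_nonneg_left (hdg σ i) ht0.le
      have h3 := mul_le_mul_of_nonneg_left (le_phi P x i) (sub_nonneg.2 ht1)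
      linarith [hg σ i]
    have h4 := mul_le_mul_of_nonneg_left h1 hlam0.le
    have h5 := mul_le_mul_of_nonneg_left (heg i) hA.lam_pos.le
    rw [kappa_eq]
    linarith
  · rw [ht_convexCombination, kappa_eq]
    have hsm : P.ht j (t • d σ) x = (1 - t) * P.h j x + t * P.ht j (d σ) x := by
      simp only [ht, inner_smul_right]; ring
    have h1 : |P.ht j (t • d σ) x - t * r * (σ j : ℝ)| ≤ P.phi x := by
      have h2 := abs_le.1 (hdh σ j)
      have h3 := abs_le.1 (abs_h_le_phi P x j)
      rw [hsm, abs_le]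
      constructor <;> nlinarith
    have h2 := abs_le.1 h1
    have h3 := abs_le.1 (heh j)
    have := hA.lam_pos
    rw [abs_le]
    constructor <;> nlinarith

/-- Uniform regularity of the constraints of the subproblem at `x`: all small perturbations of the
equality constraints can be met, with slack `r` in the inequality constraints. -/
def RegularAt (P : Problem n m p) (T : Surrogate n m) (x : Vec n) (r : ℝ) : Prop :=
  ∀ v : Fin p → ℝ, (∀ j, |v j| ≤ r) → ∃ w, infNorm w ≤ T.β ∧ x + w ∈ P.K ∧
    (∀ i, T.gt i w x ≤ P.kappa T x - r) ∧ ∀ j, |P.ht j w x - v j| ≤ P.kappa T x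

theorem RegularAt.mono {x : Vec n} {r s : ℝ} (h : P.RegularAt T x r) (hs : s ≤ r) :
    P.RegularAt T x s := fun v hv =>
  let ⟨w, h1, h2, h3, h4⟩ := h v fun j => (hv j).trans hs
  ⟨w, h1, h2, fun i => (h3 i).trans (by linarith), h4⟩

theorem exists_clamp {a k ε : ℝ} (hk : 0 ≤ k) (hε : 0 ≤ ε) (ha : |a| ≤ k + ε) :
    ∃ b, |b| ≤ k ∧ |a - b| ≤ ε := by
  have h := abs_le.1 ha
  rcases le_total a (-k) with h1 | h1
  · exact ⟨-k, by rw [abs_neg, abs_of_nonneg hk], abs_le.2 ⟨by linarith, by linarith⟩⟩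
  rcases le_total a k with h2 | h2
  · exact ⟨a, abs_le.2 ⟨h1, h2⟩, by simpa using hε⟩
  · exact ⟨k, (abs_of_nonneg hk).le, abs_le.2 ⟨by linarith, by linarith⟩⟩

/-- The regular steps at `x` have size at most `ρ < β`, so they can be shifted to end at the same
point of `K` when started from `z`. They then nearly realize every sign pattern, and
`mem_of_forall_sign` fills in a whole cube of perturbations. -/
theorem exists_regularAt_nearby (hP : P.Regular) (hA : T.Admissible P Od Ox)
    (hC : T.LocallyLipschitz Od Ox) {S : Set (Vec n)} (hS : IsCompact S) (hSK : S ⊆ P.K)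
    {x : Vec n} (hx : x ∈ S) (hMF : P.EMFCQ x) :
    ∃ r : ℝ, 0 < r ∧ ∃ δ : ℝ, 0 < δ ∧ ∀ z ∈ S, ‖z - x‖ < δ → P.RegularAt T z r := by
  obtain ⟨r, hr, hreg⟩ := exists_regular_steps hP hA (hSK hx) hMF
  obtain ⟨L, hL0, hLg, hLh, hLk⟩ := exists_lipschitz_stepViolation hP hA hC hS hSK
  have hβρ : 0 < T.β - T.ρ := sub_pos.2 hA.rho_lt_beta
  refine ⟨r / 4, by positivity, min (T.β - T.ρ) (r / (6 * (L + 1))), by positivity,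
    fun z hz hzx v hv => ?_⟩
  obtain ⟨hz1, hz2⟩ := lt_min_iff.1 hzx
  -- Two of the three units are the change of a constraint value (step and base point both move by
  -- `‖z - x‖`), the third is the change of `kappa`.
  have hsmall : 3 * (L * ‖z - x‖) ≤ r / 2 := by
    have h := (lt_div_iff₀ (by positivity)).1 hz2
    nlinarith [norm_nonneg (z - x)]
  set C : Set (Fin p → ℝ) := {v | ∃ w, infNorm w ≤ T.β ∧ z + w ∈ P.K ∧
    (∀ i, T.gt i w z ≤ P.kappa T z - r / 4) ∧ ∀ j, |P.ht j w z - v j| ≤ P.kappa T z} with hCdef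
  have hconv : Convex ℝ C := by
    rintro v ⟨d, hd, hzd, hg, hh⟩ v' ⟨e, he, hze, hg', hh'⟩ a b ha hb hab
    obtain rfl : a = 1 - b := by linarith
    refine ⟨(1 - b) • d + b • e, infNorm_convexCombination_le hb (by linarith) hd he, ?_,
      fun i => ?_, fun j => ?_⟩
    · have := hP.convex_K hzd hze ha hb hab
      convert this using 1
      module
    · refine (gt_convexCombination_le hA i (hSK hz) hd he hb (by linarith)).trans ?_
      nlinarith [hg i, hg' i]
    · rw [ht_convexCombination]
      have h1 := abs_le.1 (hh j)
      have h2 := abs_le.1 (hh' j)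
      simp only [Pi.add_apply, Pi.smul_apply, smul_eq_mul]
      rw [abs_le]
      constructor <;> nlinarith
  refine (mem_of_forall_sign hconv hr (fun σ => ?_) hv : v ∈ C)
  obtain ⟨w, hw, hxw, hwg, hwh⟩ := hreg σ
  have hw' : infNorm (w + (x - z)) ≤ T.β := by
    refine (infNorm_add_le _ _).trans ?_
    have := infNorm_le_norm (x - z)
    rw [norm_sub_rev] at this
    linarith
  have hdist : ‖w + (x - z) - w‖ + ‖z - x‖ = 2 * ‖z - x‖ := by
    rw [add_sub_cancel_left, norm_sub_rev]; ring
  have hwβ := hw.trans hA.rho_lt_beta.le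
  have hk := abs_le.1 (hLk z hz x hx)
  have hclamp : ∀ j, ∃ b, |b| ≤ P.kappa T z ∧
      |(P.ht j w x - r * (σ j : ℝ)) - b| ≤ L * ‖z - x‖ := fun j =>
    exists_clamp (kappa_nonneg hP hA (hSK hz)) (by positivity) (by linarith [hwh j])
  choose b hb hb' using hclamp
  -- Subtracting the clamped part `b` leaves an exactly attained perturbation within `r / 2` of `r
  -- σ`.
  refine ⟨fun j => P.ht j (w + (x - z)) z - b j, ⟨w + (x - z), hw', ?_, fun i => ?_, fun j => ?_⟩,
    fun j => ?_⟩
  · convert hxw using 1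
    abel
  · have := hLg i _ w hw' hwβ z hz x hx
    rw [hdist] at this
    linarith [hwg i, (abs_le.1 this).2]
  · simpa using hb j
  · have h1 := hLh j _ w hw' hwβ z hz x hx
    rw [hdist] at h1
    have h1 := abs_le.1 h1
    have h2 := abs_le.1 (hb' j)
    rw [abs_le]
    constructor <;> linarith

open Topology in
theorem exists_uniform_regularAt (hP : P.Regular) (hA : T.Admissible P Od Ox)
    (hC : T.LocallyLipschitz Od Ox) (hMF : ∀ x ∈ P.K, P.EMFCQ x) {S : Set (Vec n)}
    (hS : IsCompact S) (hSK : S ⊆ P.K) :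
    ∃ r : ℝ, 0 < r ∧ ∀ x ∈ S, P.RegularAt T x r := by
  refine hS.induction_on (p := fun A => ∃ r : ℝ, 0 < r ∧ ∀ x ∈ A, P.RegularAt T x r)
    ⟨1, one_pos, by simp⟩ ?_ ?_ ?_
  · rintro A B hAB ⟨r, hr, h⟩
    exact ⟨r, hr, fun x hx => h x (hAB hx)⟩
  · rintro A B ⟨r, hr, h⟩ ⟨s, hs, h'⟩
    refine ⟨min r s, lt_min hr hs, ?_⟩
    rintro x (hx | hx)
    · exact (h x hx).mono (min_le_left _ _)
    · exact (h' x hx).mono (min_le_right _ _)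
  · intro x hx
    obtain ⟨r, hr, δ, hδ, h⟩ := exists_regularAt_nearby hP hA hC hS hSK hx (hMF x (hSK hx))
    exact ⟨Metric.ball x δ ∩ S,
      Filter.inter_mem (mem_nhdsWithin_of_mem_nhds (Metric.ball_mem_nhds x hδ)) self_mem_nhdsWithin,
      r, hr, fun z hz => h z hz.2 (by simpa [dist_eq_norm] using hz.1)⟩

end ConstraintQualification

/-! ### Error bound and continuity of the feasible set and the solution -/

section ErrorBound

/-- A Hoffman-type error bound for the subproblem. -/
theorem RegularAt.exists_mem_subFeasible (hP : P.Regular) (hA : T.Admissible P Od Ox)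
    {x : Vec n} (hx : x ∈ P.K) {r : ℝ} (hr : 0 < r) (hreg : P.RegularAt T x r)
    {R : ℝ} (hR : ∀ v : Vec n, infNorm v ≤ T.β → ‖v‖ ≤ R) {d : Vec n} (hd : infNorm d ≤ T.β)
    (hxd : x + d ∈ P.K) {ε : ℝ} (hε : 0 ≤ ε) (hg : ∀ i, T.gt i d x ≤ P.kappa T x + ε)
    (hh : ∀ j, |P.ht j d x| ≤ P.kappa T x + ε) :
    ∃ e ∈ P.subFeasible T x, ‖e - d‖ ≤ 2 * R / r * ε := by
  have hk := kappa_nonneg hP hA hx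
  choose a ha hb using fun j => exists_clamp hk hε (hh j)
  obtain rfl | hε := hε.eq_or_lt
  · exact ⟨d, mem_subFeasible_iff.2 ⟨by simpa using hg, by simpa using hh, hd, hxd⟩, by simp⟩
  -- This weight balances excess and slack: `(1 - t) * ε = t * r`.
  set t := ε / (ε + r) with ht
  have hεr : 0 < ε + r := by positivity
  have ht0 : 0 ≤ t := by positivity
  have h1t : 1 - t = r / (ε + r) := by rw [ht]; field_simp; ring
  have h1t0 : 0 ≤ 1 - t := by rw [h1t]; positivity
  have htr : t * r = (1 - t) * ε := by rw [h1t, ht]; ring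
  -- Since `t * (r / ε) = 1 - t`, this perturbation cancels the excess of the equality constraints
  -- over their clamped values `a` exactly.
  obtain ⟨w, hw, hxw, hwg, hwh⟩ := hreg (fun j => -(r / ε * (P.ht j d x - a j))) fun j => by
    rw [abs_neg, abs_mul, abs_of_pos (by positivity)]
    calc r / ε * |P.ht j d x - a j| ≤ r / ε * ε := by gcongr; exact hb j
      _ = r := by field_simp
  refine ⟨(1 - t) • d + t • w, mem_subFeasible_iff.2 ⟨fun i => ?_, fun j => ?_,
    infNorm_convexCombination_le ht0 (by linarith) hd hw, ?_⟩, ?_⟩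
  · refine (gt_convexCombination_le hA i hx hd hw ht0 (by linarith)).trans ?_
    have h1 := mul_le_mul_of_nonneg_left (hg i) h1t0
    have h2 := mul_le_mul_of_nonneg_left (hwg i) ht0
    linarith
  · rw [ht_convexCombination]
    have hcancel : t * (r / ε * (P.ht j d x - a j)) = (1 - t) * (P.ht j d x - a j) := by
      rw [h1t, ht]; field_simp
    have h1 := abs_le.1 (hwh j)
    have h2 := abs_le.1 (ha j)
    have h3 := mul_le_mul_of_nonneg_left h1.1 ht0
    have h4 := mul_le_mul_of_nonneg_left h1.2 ht0
    have h5 := mul_le_mul_of_nonneg_left h2.1 h1t0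
    have h6 := mul_le_mul_of_nonneg_left h2.2 h1t0
    rw [abs_le]
    constructor <;> linarith
  · have := hP.convex_K hxd hxw h1t0 ht0 (by ring)
    convert this using 1
    module
  · have h1 : (1 - t) • d + t • w - d = t • (w - d) := by module
    rw [h1, norm_smul, Real.norm_of_nonneg ht0]
    have h2 : ‖w - d‖ ≤ 2 * R := (norm_sub_le _ _).trans (by linarith [hR w hw, hR d hd])
    have h3 : t ≤ ε / r := by rw [ht]; gcongr; linarith
    calc t * ‖w - d‖ ≤ ε / r * (2 * R) := by gcongr
      _ = _ := by ring

/-- The feasible set of the subproblem is a Lipschitz continuous function of `x`, uniformly on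
compact sets. -/
theorem exists_subFeasible_lipschitz (hP : P.Regular) (hA : T.Admissible P Od Ox)
    (hC : T.LocallyLipschitz Od Ox) (hMF : ∀ x ∈ P.K, P.EMFCQ x) {S : Set (Vec n)}
    (hS : IsCompact S) (hSK : S ⊆ P.K) :
    ∃ L : ℝ, 0 ≤ L ∧ ∀ y ∈ S, ∀ z ∈ S, ∀ d ∈ P.subFeasible T y, ∃ e ∈ P.subFeasible T z,
      ‖e - d‖ ≤ L * ‖y - z‖ := by
  obtain ⟨r, hr, hreg⟩ := exists_uniform_regularAt hP hA hC hMF hS hSK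
  obtain ⟨L, hL0, hLg, hLh, hLk⟩ := exists_lipschitz_stepViolation hP hA hC hS hSK
  obtain ⟨R, hR0, hR⟩ := exists_norm_le_of_infNorm_le (n := n) T.β
  have hβ := beta_pos hA
  set M := 1 + R / T.β with hM
  have hM0 : 0 ≤ M := by positivity
  refine ⟨2 * R / r * (L * (M + 2)) + M, by positivity, fun y hy z hz d hd => ?_⟩
  obtain ⟨hdg, hdh, hdβ, hyd⟩ := mem_subFeasible_iff.1 hd
  obtain ⟨d₀, hd₀, hzd₀, hdist⟩ := exists_shifted_step hP.convex_K (hSK hz) hβ hdβ hyd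
  have hdist' : ‖d₀ - d‖ ≤ M * ‖y - z‖ := by
    refine hdist.trans ?_
    rw [hM]
    gcongr
    exact hR d hdβ
  have hstep : L * (‖d₀ - d‖ + ‖z - y‖) ≤ L * ((M + 1) * ‖y - z‖) := by
    rw [norm_sub_rev z y]
    gcongr
    linarith
  have hk := abs_le.1 (hLk y hy z hz)
  -- The violation of `d₀` at `z` is at most `L (M + 1) ‖y - z‖` from the constraint functions plus
  -- `L ‖y - z‖` from `kappa`.
  obtain ⟨e, he, hed⟩ := (hreg z hz).exists_mem_subFeasible hP hA (hSK hz) hr hR hd₀ hzd₀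
    (ε := L * (M + 2) * ‖y - z‖) (by positivity)
    (fun i => by
      have := (abs_le.1 (hLg i d₀ d hd₀ hdβ z hz y hy)).2
      linarith [hdg i])
    (fun j => by
      have h1 := hLh j d₀ d hd₀ hdβ z hz y hy
      have h2 := abs_sub_abs_le_abs_sub (P.ht j d₀ z) (P.ht j d y)
      linarith [hdh j])
  refine ⟨e, he, ?_⟩
  have h := norm_sub_le_norm_sub_add_norm_sub e d₀ d
  linarith

end ErrorBound

/-- Hölder continuity of the solution map of the subproblem on compact sets. -/
theorem exists_solutionMap_holder (hP : P.Regular) (hA : T.Admissible P Od Ox)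
    (hC : T.LocallyLipschitz Od Ox) (hMF : ∀ x ∈ P.K, P.EMFCQ x) {S : Set (Vec n)}
    (hS : IsCompact S) (hSK : S ⊆ P.K) :
    ∃ μ : ℝ, 0 < μ ∧ ∀ y ∈ S, ∀ z ∈ S,
      ‖P.solutionMap T y - P.solutionMap T z‖ ≤ μ * ‖y - z‖ ^ (1 / 2 : ℝ) := by
  obtain ⟨L, hL0, hL⟩ := exists_subFeasible_lipschitz hP hA hC hMF hS hSK
  obtain ⟨L₁, hL₁0, hL₁⟩ := exists_lipschitz_joint (ι := Unit) (F := fun _ => T.ft) hA hS hSK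
    fun _ => hC.ft_locallyLipschitz
  obtain ⟨L₂, hL₂0, hL₂⟩ := exists_lipschitz_q hP hS T.β
  obtain ⟨c, hc0, hc⟩ := hA.ft_strongConvexOn
  obtain ⟨B, hB⟩ := hS.isBounded.exists_norm_le
  have hobj : ∀ y ∈ S, ∀ z ∈ S, ∀ d ∈ P.subFeasible T y, ∃ e ∈ P.subFeasible T z,
      ‖e - d‖ ≤ L * ‖y - z‖ ∧
      P.subObjective T z e ≤ P.subObjective T y d + (L₁ + L₂) * (L + 1) * ‖y - z‖ := by
    intro y hy z hz d hd
    obtain ⟨e, he, hed⟩ := hL y hy z hz d hd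
    refine ⟨e, he, hed, ?_⟩
    have h1 := (abs_le.1 (hL₁ () e d he.2.2.1 hd.2.2.1 z hz y hy)).2
    have h2 := (abs_le.1 (hL₂ e d he.2.2.1 hd.2.2.1 z hz y hy he.2.2.2 hd.2.2.2)).2
    have h3 : (L₁ + L₂) * (‖e - d‖ + ‖z - y‖) ≤ (L₁ + L₂) * ((L + 1) * ‖y - z‖) := by
      rw [norm_sub_rev z y]
      gcongr
      linarith
    unfold subObjective
    linarith
  set N := (L₁ + L₂) * (L + 1) with hN
  have hN0 : 0 ≤ N := by positivity
  -- The first term absorbs the Lipschitz part, since `‖y - z‖ ≤ 2 * |B|` on `S`; the second comes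
  -- from growth `c / 4` against a gap `2 * N * ‖y - z‖`; the `1` only ensures positivity.
  refine ⟨L * √(2 * |B|) + √(8 * N / c) + 1, by positivity, fun y hy z hz => ?_⟩
  rw [← Real.sqrt_eq_rpow]
  have hsy := isSubSolution_solutionMap hP hA (hSK hy)
  have hsz := isSubSolution_solutionMap hP hA (hSK hz)
  set dy := P.solutionMap T y
  set dz := P.solutionMap T z
  obtain ⟨e, he, hed, heo⟩ := hobj y hy z hz dy hsy.1
  obtain ⟨e', he', -, heo'⟩ := hobj z hz y hy dz hsz.1
  have hgrow := isSubSolution_quadratic_growth hP hA hc (hSK hz) hsz he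
  have hmin : P.subObjective T y dy ≤ P.subObjective T y e' := hsy.2 he'
  rw [norm_sub_rev z y] at heo'
  have hsq : ‖e - dz‖ ^ 2 ≤ 8 * N / c * ‖y - z‖ := by
    rw [div_mul_eq_mul_div, le_div_iff₀ hc0]
    linarith
  have h1 : ‖e - dz‖ ≤ √(8 * N / c) * √‖y - z‖ := by
    rw [← Real.sqrt_mul (by positivity)]
    exact Real.le_sqrt_of_sq_le hsq
  have h2 : ‖y - z‖ ≤ √(2 * |B|) * √‖y - z‖ := by
    have hyz : ‖y - z‖ ≤ 2 * |B| :=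
      (norm_sub_le _ _).trans (by linarith [hB y hy, hB z hz, le_abs_self B])
    calc ‖y - z‖ = √‖y - z‖ * √‖y - z‖ := (Real.mul_self_sqrt (norm_nonneg _)).symm
      _ ≤ √(2 * |B|) * √‖y - z‖ := by gcongr
  have h3 := norm_sub_le_norm_sub_add_norm_sub dy e dz
  rw [norm_sub_rev dy e] at h3
  have h4 := mul_le_mul_of_nonneg_left h2 hL0
  have h5 := Real.sqrt_nonneg ‖y - z‖
  linarith

end Problem
end GhostPenalty

end

theorem proposition5 {n m p : ℕ} (P : GhostPenalty.Problem n m p)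
    (T : GhostPenalty.Surrogate n m) (Od Ox : Set (GhostPenalty.Vec n))
    (hP : P.Regular) (hA : T.Admissible P Od Ox) (hC : T.LocallyLipschitz Od Ox)
    (hMF : ∀ x ∈ P.K, P.EMFCQ x)
    (S : Set (GhostPenalty.Vec n)) (hS : IsCompact S) (hSK : S ⊆ P.K) :
    (∀ x ∈ P.K, ∃! d, P.IsSubSolution T x d) ∧
    ∃ μ : ℝ, 0 < μ ∧ ∀ y ∈ S, ∀ z ∈ S,
      ‖P.solutionMap T y - P.solutionMap T z‖ ≤ μ * ‖y - z‖ ^ (1 / 2 : ℝ) := by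
  exact ⟨fun x hx => GhostPenalty.Problem.existsUnique_isSubSolution hP hA hx,
    GhostPenalty.Problem.exists_solutionMap_holder hP hA hC hMF hS hSK⟩
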